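/- Let $G$ be a locally compact group with a left Haar measure $\mu$, and let $\kappa(G)$ be its compact covering number, i.e. the least cardinality of a family of compact subsets of $G$ whose union is $G$. Let $w : G \to (0,\infty)$ be a weight, i.e. a continuous function with $w(st) \le w(s)w(t)$ for all $s,t \in G$ and $w(e) = 1$. Let $L_1(G,w)$ be the complex normed space of all (classes of) functions $f : G \to \mathbb{C}$ with $wf \in L_1(G,\mu)$, with the norm $\|f\|_w = \|wf\|_1$. Then $L_1(G,w)$ has Mazur's property of level $\kappa(G)\cdot\aleph_0$. That is: let $m \in L_1(G,w)^{**}$ be such that for every bounded $w^*$-convergent net $(h_i)_{i \in I}$ in $L_1(G,w)^*$ whose directed index set satisfies $|I| \le \kappa(G)\cdot\aleph_0$, the net of scalars $(\langle m, h_i\rangle)_{i\in I}$ converges. Then $m$ belongs to the canonical image of $L_1(G,w)$ in $L_1(G,w)^{**}$. -/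

import Mathlib

open MeasureTheory Filter Topology

/-- A weight on a topological group: a positive continuous submultiplicative function with value
`1` at the identity. -/
structure GroupWeight (G : Type*) [TopologicalSpace G] [Group G] where
  /-- The underlying function. -/
  toFun : G → ℝ
  continuous_toFun : Continuous toFun
  pos (s : G) : 0 < toFun s
  map_mul_le (s t : G) : toFun (s * t) ≤ toFun s * toFun t
  map_one : toFun 1 = 1

instance {G : Type*} [TopologicalSpace G] [Group G] : CoeFun (GroupWeight G) (fun _ => G → ℝ) :=
  ⟨GroupWeight.toFun⟩

/-- The least cardinality of a covering of `G` by compact sets. -/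
noncomputable def compactCoveringNumber (G : Type*) [TopologicalSpace G] : Cardinal :=
  sInf {c | ∃ S : Set (Set G), (∀ K ∈ S, IsCompact K) ∧ ⋃₀ S = Set.univ ∧ Cardinal.mk S = c}

section WeightedL1

variable {G : Type*} [TopologicalSpace G] [Group G] [MeasurableSpace G]

/-- The space `L₁(G, w)` of (classes of) functions `f` such that `w f ∈ L₁(G)`. -/
noncomputable def WeightedL1 (μ : Measure G) (w : GroupWeight G) : Submodule ℂ (G →ₘ[μ] ℂ) where
  carrier := {f | Integrable (fun x => (w x : ℂ) * f x) μ}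
  zero_mem' := by
    refine (integrable_zero G ℂ μ).congr ?_
    filter_upwards [AEEqFun.coeFn_zero (α := G) (β := ℂ) (μ := μ)] with x hx
    simp [hx]
  add_mem' {f g} hf hg := by
    refine (Integrable.add hf hg).congr ?_
    filter_upwards [AEEqFun.coeFn_add f g] with x hx
    simp [hx, mul_add]
  smul_mem' c f hf := by
    refine (Integrable.smul c hf).congr ?_
    filter_upwards [AEEqFun.coeFn_smul c f] with x hx
    simp [hx, mul_left_comm]

theorem WeightedL1.integrable {μ : Measure G} {w : GroupWeight G} (f : WeightedL1 μ w) :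
    Integrable (fun x => (w x : ℂ) * (f : G →ₘ[μ] ℂ) x) μ := f.2

/-- Multiplication by the weight, `f ↦ w f`, as a linear map from `L₁(G, w)` to `L₁(G)`. -/
noncomputable def WeightedL1.mulWeight (μ : Measure G) (w : GroupWeight G) :
    WeightedL1 μ w →ₗ[ℂ] Lp ℂ 1 μ where
  toFun f := Integrable.toL1 (fun x => (w x : ℂ) * (f : G →ₘ[μ] ℂ) x) (WeightedL1.integrable f)
  map_add' f g := by
    refine Eq.trans ((Integrable.toL1_eq_toL1_iff _ _ _ ((WeightedL1.integrable f).add (WeightedL1.integrable g))).2 ?_)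
      (Integrable.toL1_add _ _ (WeightedL1.integrable f) (WeightedL1.integrable g))
    filter_upwards [AEEqFun.coeFn_add (f : G →ₘ[μ] ℂ) g] with x hx
    simp [hx, mul_add]
  map_smul' c f := by
    refine Eq.trans ((Integrable.toL1_eq_toL1_iff _ _ _ ((WeightedL1.integrable f).smul c)).2 ?_)
      (Integrable.toL1_smul _ (WeightedL1.integrable f) c)
    filter_upwards [AEEqFun.coeFn_smul c (f : G →ₘ[μ] ℂ)] with x hx
    simp [hx, mul_left_comm]

theorem WeightedL1.mulWeight_injective (μ : Measure G) (w : GroupWeight G) :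
    Function.Injective (WeightedL1.mulWeight μ w) := by
  intro f g h
  have h' := (Integrable.toL1_eq_toL1_iff _ _ (WeightedL1.integrable f) (WeightedL1.integrable g)).1 h
  refine Subtype.ext (AEEqFun.ext ?_)
  filter_upwards [h'] with x hx
  exact mul_left_cancel₀ (by exact_mod_cast (w.pos x).ne') hx

/-- The norm of `L₁(G, w)` is `‖f‖_w = ‖w f‖₁`. -/
noncomputable instance WeightedL1.instNormedAddCommGroup (μ : Measure G) (w : GroupWeight G) :
    NormedAddCommGroup (WeightedL1 μ w) :=
  NormedAddCommGroup.induced _ _ (WeightedL1.mulWeight μ w) (WeightedL1.mulWeight_injective μ w)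

noncomputable instance WeightedL1.instNormedSpace (μ : Measure G) (w : GroupWeight G) :
    NormedSpace ℂ (WeightedL1 μ w) :=
  NormedSpace.induced _ _ _ (WeightedL1.mulWeight μ w)

end WeightedL1

/-- Mazur's property of level `κ`: a functional `m ∈ X**` lies in (the canonical image of) `X`
as soon as it maps every bounded weak-* convergent net in `X*`, indexed by a directed set of
cardinality at most `κ`, to a convergent net of scalars. -/
def HasMazurProperty.{u, v} (X : Type v) [NormedAddCommGroup X] [NormedSpace ℂ X]
    (κ : Cardinal.{u}) : Prop :=
  ∀ m : StrongDual ℂ (StrongDual ℂ X),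
    (∀ (ι : Type u) [Preorder ι] [IsDirectedOrder ι] [Nonempty ι], Cardinal.mk ι ≤ κ →
      ∀ h : ι → StrongDual ℂ X, (∃ C : ℝ, ∀ i, ‖h i‖ ≤ C) →
        (∃ l : WeakDual ℂ X,
          Tendsto (fun i => StrongDual.toWeakDual (h i)) atTop (𝓝 l)) →
        ∃ a : ℂ, Tendsto (fun i => m (h i)) atTop (𝓝 a)) →
    ∃ f : X, NormedSpace.inclusionInDoubleDual ℂ X f = m

/-! Multiplication by `w` is an isometry of `L₁(G, w)` onto `L₁(G)`, so only `L₁(G)` matters. Write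
κ for `κ(G)·ℵ₀`. An open σ-compact subgroup has at most κ cosets, so `G` splits into at most κ
disjoint sets `A j` of finite measure (`hasMazurProperty_L1_group`).

A functional `m` that sends the nets in question to convergent ones also respects their limits
(`PreservesNetLimits.of_convergent`). Hence `B ↦ m(1_B)` is countably additive and vanishes on null
sets. Its Radon–Nikodym density on `A j` is some `f j` in `L¹` with `m(φ 1_{A j}) = φ(f j)` for all
`φ` (`exists_L1_of_preservesNetLimits`). The norms of the `f j` sum to at most `‖m‖`. Since `φ 1_{⋃
j ∈ F, A j}` tends weak-* to `φ` along the finite sets `F` of indices, `m` is evaluation at `∑ f j`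
(`hasMazurProperty_L1`).

As `μ` need not be σ-finite, functionals on `L¹` are kept abstract and cut down by the operators
`projL1`; they are represented by bounded functions only on sets of finite measure. -/

/-! ### Multiplication operators and restriction to sets on `L¹` -/

section MultiplicationOperators

variable {Ω : Type*} [MeasurableSpace Ω]

/-- `h` is strongly measurable and bounded everywhere. -/
def IsBddMeas (h : Ω → ℂ) : Prop := StronglyMeasurable h ∧ ∃ C, ∀ x, ‖h x‖ ≤ C

theorem IsBddMeas.integrable_mul {h : Ω → ℂ} (H : IsBddMeas h) {μ : Measure Ω} {g : Ω → ℂ}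
    (hg : Integrable g μ) : Integrable (fun x => h x * g x) μ :=
  let ⟨_, hC⟩ := H.2
  hg.bdd_mul H.1.aestronglyMeasurable (Eventually.of_forall hC)

theorem IsBddMeas.indicator_one {B : Set Ω} (hB : MeasurableSet B) :
    IsBddMeas (B.indicator (1 : Ω → ℂ)) := by
  refine ⟨stronglyMeasurable_one.indicator hB, 1, fun x => ?_⟩
  by_cases hx : x ∈ B <;> simp [hx]

theorem IsBddMeas.simpleFunc (s : SimpleFunc Ω ℂ) : IsBddMeas s :=
  ⟨s.stronglyMeasurable, s.exists_forall_norm_le⟩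

open Classical in
/-- Multiplication by a bounded measurable function on `L¹` (zero if the function is not bounded
measurable). -/
noncomputable def mulL1 (μ : Measure Ω) (h : Ω → ℂ) : Lp ℂ 1 μ →L[ℂ] Lp ℂ 1 μ :=
  if H : IsBddMeas h then
    LinearMap.mkContinuousOfExistsBound
      { toFun := fun g => (H.integrable_mul (L1.integrable_coeFn g)).toL1 _
        map_add' := fun f g => by
          rw [← Integrable.toL1_add, Integrable.toL1_eq_toL1_iff]
          filter_upwards [Lp.coeFn_add f g] with x hx
          rw [hx, Pi.add_apply, Pi.add_apply, mul_add]
        map_smul' := fun c f => by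
          rw [RingHom.id_apply, ← Integrable.toL1_smul, Integrable.toL1_eq_toL1_iff]
          filter_upwards [Lp.coeFn_smul c f] with x hx
          rw [hx, Pi.smul_apply, mul_smul_comm] }
      (by
        obtain ⟨C, hC⟩ := H.2
        refine ⟨C, fun g => ?_⟩
        change ‖(H.integrable_mul (L1.integrable_coeFn g)).toL1 _‖ ≤ _
        rw [L1.norm_of_fun_eq_integral_norm, L1.norm_eq_integral_norm, ← integral_const_mul]
        refine integral_mono (H.integrable_mul (L1.integrable_coeFn g)).norm
          ((L1.integrable_coeFn g).norm.const_mul C) fun x => ?_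
        simp only [norm_mul]
        exact mul_le_mul_of_nonneg_right (hC x) (norm_nonneg _))
  else 0

variable {μ : Measure Ω}

theorem mulL1_apply {h : Ω → ℂ} (H : IsBddMeas h) (g : Lp ℂ 1 μ) :
    mulL1 μ h g = (H.integrable_mul (L1.integrable_coeFn g)).toL1 _ := by
  rw [mulL1, dif_pos H]; rfl

theorem coeFn_mulL1 {h : Ω → ℂ} (H : IsBddMeas h) (g : Lp ℂ 1 μ) :
    mulL1 μ h g =ᵐ[μ] fun x => h x * g x := by
  rw [mulL1_apply H]; exact Integrable.coeFn_toL1 _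

theorem norm_mulL1_le {h : Ω → ℂ} (hm : StronglyMeasurable h) {C : ℝ} (hC0 : 0 ≤ C)
    (hC : ∀ x, ‖h x‖ ≤ C) : ‖mulL1 μ h‖ ≤ C := by
  have H : IsBddMeas h := ⟨hm, C, hC⟩
  refine ContinuousLinearMap.opNorm_le_bound _ hC0 fun g => ?_
  rw [mulL1_apply H, L1.norm_of_fun_eq_integral_norm, L1.norm_eq_integral_norm,
    ← integral_const_mul]
  refine integral_mono (H.integrable_mul (L1.integrable_coeFn g)).norm
    ((L1.integrable_coeFn g).norm.const_mul C) fun x => ?_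
  simp only [norm_mul]
  exact mul_le_mul_of_nonneg_right (hC x) (norm_nonneg _)

/-- Multiplication by the indicator function of a measurable set on `L¹`. -/
noncomputable def projL1 (μ : Measure Ω) (B : Set Ω) : Lp ℂ 1 μ →L[ℂ] Lp ℂ 1 μ :=
  mulL1 μ (B.indicator 1)

theorem coeFn_projL1 {B : Set Ω} (hB : MeasurableSet B) (g : Lp ℂ 1 μ) :
    projL1 μ B g =ᵐ[μ] B.indicator g := by
  filter_upwards [coeFn_mulL1 (IsBddMeas.indicator_one hB) g] with x hx
  rw [projL1, hx]
  by_cases h : x ∈ B <;> simp [h]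

/-- The default value of `mulL1` gives exactly the vanishing on nonmeasurable sets that a
`VectorMeasure` requires. -/
theorem projL1_of_not_measurableSet {B : Set Ω} (hB : ¬ MeasurableSet B) : projL1 μ B = 0 := by
  rw [projL1, mulL1, dif_neg]
  rintro ⟨h, -⟩
  exact hB ((measurable_indicator_const_iff (1 : ℂ)).1 h.measurable)

theorem norm_projL1_le (μ : Measure Ω) (B : Set Ω) : ‖projL1 μ B‖ ≤ 1 := by
  by_cases hB : MeasurableSet B
  · refine norm_mulL1_le (stronglyMeasurable_one.indicator hB) zero_le_one fun x => ?_
    by_cases h : x ∈ B <;> simp [h]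
  · simp [projL1_of_not_measurableSet hB]

theorem projL1_projL1 {B C : Set Ω} (hB : MeasurableSet B) (hC : MeasurableSet C)
    (g : Lp ℂ 1 μ) : projL1 μ B (projL1 μ C g) = projL1 μ (B ∩ C) g := by
  refine Lp.ext ?_
  filter_upwards [coeFn_projL1 hB (projL1 μ C g), coeFn_projL1 hC g,
    coeFn_projL1 (hB.inter hC) g] with x h1 h2 h3
  rw [h1, h3, ← Set.indicator_indicator]
  by_cases h : x ∈ B <;> simp [h, h2]

theorem projL1_congr_ae {B C : Set Ω} (hB : MeasurableSet B) (hC : MeasurableSet C)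
    (h : B =ᵐ[μ] C) (g : Lp ℂ 1 μ) : projL1 μ B g = projL1 μ C g := by
  refine Lp.ext ?_
  filter_upwards [coeFn_projL1 hB g, coeFn_projL1 hC g, h.mem_iff] with x h1 h2 h3
  rw [h1, h2]
  by_cases hx : x ∈ B
  · simp [hx, h3.1 hx]
  · simp [hx, mt h3.2 hx]

@[simp] theorem projL1_empty : projL1 μ ∅ = 0 := by
  ext1 g
  refine Lp.ext ?_
  filter_upwards [coeFn_projL1 MeasurableSet.empty g, Lp.coeFn_zero ℂ 1 μ] with x h1 h2
  rw [h1, zero_apply, h2]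
  simp

@[simp] theorem projL1_univ : projL1 μ Set.univ = .id ℂ _ := by
  ext1 g
  refine Lp.ext ?_
  filter_upwards [coeFn_projL1 MeasurableSet.univ g] with x h1
  rw [h1]
  simp

theorem norm_projL1_apply {B : Set Ω} (hB : MeasurableSet B) (g : Lp ℂ 1 μ) :
    ‖projL1 μ B g‖ = ∫ x in B, ‖g x‖ ∂μ := by
  rw [L1.norm_eq_integral_norm, ← integral_indicator hB]
  refine integral_congr_ae ?_
  filter_upwards [coeFn_projL1 hB g] with x hx
  rw [hx, norm_indicator_eq_indicator_norm]

theorem projL1_add_of_disjoint {B C : Set Ω} (hB : MeasurableSet B) (hC : MeasurableSet C)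
    (hd : Disjoint B C) : projL1 μ B + projL1 μ C = projL1 μ (B ∪ C) := by
  ext1 g
  refine Lp.ext ?_
  filter_upwards [coeFn_projL1 hB g, coeFn_projL1 hC g, coeFn_projL1 (hB.union hC) g,
    Lp.coeFn_add (projL1 μ B g) (projL1 μ C g)] with x h1 h2 h3 h4
  rw [add_apply, h4, h3, Pi.add_apply, h1, h2, Set.indicator_union_of_disjoint hd]

theorem sum_projL1 {J : Type*} {B : J → Set Ω} (hB : ∀ j, MeasurableSet (B j))
    (hd : Pairwise (Function.onFun Disjoint B)) (F : Finset J) :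
    ∑ j ∈ F, projL1 μ (B j) = projL1 μ (⋃ j ∈ F, B j) := by
  classical
  induction F using Finset.induction_on with
  | empty => simp
  | insert a s ha ih =>
    rw [Finset.sum_insert ha, ih, Finset.set_biUnion_insert, projL1_add_of_disjoint (hB a)
      (s.measurableSet_biUnion fun j _ => hB j)]
    refine Set.disjoint_iUnion₂_right.2 fun j hj => hd ?_
    rintro rfl
    exact ha hj

/-- The error of a finite partial sum has norm `∫ ‖g‖` over the part of `S` not yet covered. The
index set may be uncountable, so `hg` stands in for countable additivity. -/
theorem hasSum_projL1 {J : Type*} {B : J → Set Ω} (hB : ∀ j, MeasurableSet (B j))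
    (hd : Pairwise (Function.onFun Disjoint B)) {S : Set Ω} (hS : MeasurableSet S)
    (hBS : ∀ j, B j ⊆ S) {g : Lp ℂ 1 μ}
    (hg : HasSum (fun j => ∫ x in B j, ‖g x‖ ∂μ) (∫ x in S, ‖g x‖ ∂μ)) :
    HasSum (fun j => projL1 μ (B j) g) (projL1 μ S g) := by
  rw [HasSum, SummationFilter.unconditional_filter] at hg ⊢
  rw [tendsto_iff_norm_sub_tendsto_zero]
  have key : ∀ F : Finset J, ‖∑ j ∈ F, projL1 μ (B j) g - projL1 μ S g‖
      = ∫ x in S, ‖g x‖ ∂μ - ∑ j ∈ F, ∫ x in B j, ‖g x‖ ∂μ := by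
    intro F
    have hF : MeasurableSet (⋃ j ∈ F, B j) := F.measurableSet_biUnion fun j _ => hB j
    have hFS : (⋃ j ∈ F, B j) ⊆ S := Set.iUnion₂_subset fun j _ => hBS j
    have h1 : projL1 μ S = projL1 μ (⋃ j ∈ F, B j) + projL1 μ (S \ ⋃ j ∈ F, B j) := by
      rw [projL1_add_of_disjoint hF (hS.diff hF) Set.disjoint_sdiff_right,
        Set.union_sdiff_cancel hFS]
    have hi : Integrable (fun x => ‖g x‖) μ := (L1.integrable_coeFn g).norm
    rw [← sum_apply, sum_projL1 hB hd, h1, add_apply, sub_add_cancel_left, norm_neg,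
      norm_projL1_apply (hS.diff hF), setIntegral_sdiff hF hi.integrableOn hFS,
      integral_biUnion_finset F (fun j _ => hB j) (hd.set_pairwise _)
        fun j _ => hi.integrableOn]
  simp_rw [key]
  simpa using hg.const_sub (∫ x in S, ‖g x‖ ∂μ)

theorem hasSum_projL1_iUnion {J : Type*} [Countable J] {B : J → Set Ω}
    (hB : ∀ j, MeasurableSet (B j)) (hd : Pairwise (Function.onFun Disjoint B)) (g : Lp ℂ 1 μ) :
    HasSum (fun j => projL1 μ (B j) g) (projL1 μ (⋃ j, B j) g) :=
  hasSum_projL1 hB hd (MeasurableSet.iUnion hB) (Set.subset_iUnion B)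
    (hasSum_integral_iUnion hB hd (L1.integrable_coeFn g).norm.integrableOn)

/-- The integral as a functional on `L¹`. -/
noncomputable def intL1 (μ : Measure Ω) : StrongDual ℂ (Lp ℂ 1 μ) :=
  LinearMap.mkContinuous
    { toFun := fun g => ∫ x, g x ∂μ
      map_add' := fun f g => by
        rw [← integral_add (L1.integrable_coeFn f) (L1.integrable_coeFn g)]
        exact integral_congr_ae (Lp.coeFn_add f g)
      map_smul' := fun c f => by
        rw [RingHom.id_apply, ← integral_smul]
        exact integral_congr_ae (Lp.coeFn_smul c f) }
    1 fun g => by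
      rw [one_mul, L1.norm_eq_integral_norm]
      exact norm_integral_le_integral_norm _

theorem intL1_apply (g : Lp ℂ 1 μ) : intL1 μ g = ∫ x, g x ∂μ := rfl

theorem norm_intL1_le (μ : Measure Ω) : ‖intL1 μ‖ ≤ 1 := by
  refine ContinuousLinearMap.opNorm_le_bound _ zero_le_one fun g => ?_
  rw [intL1_apply, one_mul, L1.norm_eq_integral_norm]
  exact norm_integral_le_integral_norm _

theorem intL1_mulL1 {h : Ω → ℂ} (H : IsBddMeas h) (g : Lp ℂ 1 μ) :
    intL1 μ (mulL1 μ h g) = ∫ x, h x * g x ∂μ := by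
  rw [intL1_apply]; exact integral_congr_ae (coeFn_mulL1 H g)

end MultiplicationOperators

/-! ### Radon–Nikodym densities and functionals on sets of finite measure -/

section Densities

variable {Ω : Type*} [MeasurableSpace Ω] {μ : Measure Ω}

theorem MeasureTheory.SignedMeasure.setIntegral_rnDeriv_of_null (ν : SignedMeasure Ω) (μ : Measure Ω)
    [SigmaFinite μ] (hν : ∀ B, MeasurableSet B → μ B = 0 → ν B = 0) {B : Set Ω}
    (hB : MeasurableSet B) : ∫ x in B, ν.rnDeriv μ x ∂μ = ν B := by
  have h := SignedMeasure.withDensityᵥ_rnDeriv_eq ν μ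
    (VectorMeasure.AbsolutelyContinuous.mk fun s hs h0 =>
      hν s hs (by rwa [Measure.toENNRealVectorMeasure_apply_measurable hs] at h0))
  rw [← withDensityᵥ_apply (SignedMeasure.integrable_rnDeriv ν μ) hB, h]

/-- Radon–Nikodym theorem for complex measures on a set of finite measure. -/
theorem MeasureTheory.ComplexMeasure.exists_density (ν : ComplexMeasure Ω) {A : Set Ω} (hA : MeasurableSet A)
    (hfin : μ A ≠ ⊤) (hν : ∀ B, MeasurableSet B → μ B = 0 → ν B = 0) :
    ∃ f : Ω → ℂ, StronglyMeasurable f ∧ Integrable f μ ∧ (∀ x ∉ A, f x = 0) ∧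
      ∀ B, MeasurableSet B → ∫ x in B, f x ∂μ = ν (B ∩ A) := by
  have : IsFiniteMeasure (μ.restrict A) := ⟨by simpa using hfin.lt_top⟩
  let c : ComplexMeasure Ω := ν.restrict A
  have hc : ∀ B, MeasurableSet B → c B = ν (B ∩ A) := fun B hB =>
    VectorMeasure.restrict_apply _ hA hB
  have hc0 : ∀ B, MeasurableSet B → μ.restrict A B = 0 → c B = 0 := fun B hB h0 => by
    rw [hc B hB]
    exact hν _ (hB.inter hA) (by rwa [Measure.restrict_apply hB] at h0)
  let r : Ω → ℝ := (ComplexMeasure.re c).rnDeriv (μ.restrict A)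
  let i : Ω → ℝ := (ComplexMeasure.im c).rnDeriv (μ.restrict A)
  have hri : Integrable r (μ.restrict A) := SignedMeasure.integrable_rnDeriv _ _
  have hii : Integrable i (μ.restrict A) := SignedMeasure.integrable_rnDeriv _ _
  have hr : ∀ B, MeasurableSet B → ∫ x in B, r x ∂(μ.restrict A) = (c B).re := fun B hB =>
    MeasureTheory.SignedMeasure.setIntegral_rnDeriv_of_null (ComplexMeasure.re c) _
      (fun B hB h0 => congrArg Complex.re (hc0 B hB h0)) hB
  have hi : ∀ B, MeasurableSet B → ∫ x in B, i x ∂(μ.restrict A) = (c B).im := fun B hB =>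
    MeasureTheory.SignedMeasure.setIntegral_rnDeriv_of_null (ComplexMeasure.im c) _
      (fun B hB h0 => congrArg Complex.im (hc0 B hB h0)) hB
  let k : Ω → ℂ := fun x => r x + i x * Complex.I
  have hk : StronglyMeasurable k := by
    have h1 : Measurable r := SignedMeasure.measurable_rnDeriv _ _
    have h2 : Measurable i := SignedMeasure.measurable_rnDeriv _ _
    exact Measurable.stronglyMeasurable (by fun_prop)
  have hki : Integrable k (μ.restrict A) := hri.ofReal.add (hii.ofReal.mul_const _)
  refine ⟨A.indicator k, hk.indicator hA, (integrable_indicator_iff hA).2 hki,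
    fun x hx => Set.indicator_of_notMem hx _, fun B hB => ?_⟩
  rw [setIntegral_indicator hA, ← Measure.restrict_restrict hB, ← hc B hB,
    integral_add hri.integrableOn.ofReal (hii.integrableOn.ofReal.mul_const _),
    integral_mul_const, integral_complex_ofReal, integral_complex_ofReal, hr B hB, hi B hB,
    Complex.re_add_im]

/-- The complex measure `B ↦ φ (g 1_B)` associated with a functional `φ` on `L¹` and `g ∈ L¹`. -/
noncomputable def dualMeasure (φ : StrongDual ℂ (Lp ℂ 1 μ)) (g : Lp ℂ 1 μ) :
    ComplexMeasure Ω where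
  measureOf' B := φ (projL1 μ B g)
  empty' := by simp
  not_measurable' B hB := by simp [projL1_of_not_measurableSet hB]
  m_iUnion' _ hB hd := (hasSum_projL1_iUnion hB hd g).mapL φ

theorem dualMeasure_apply (φ : StrongDual ℂ (Lp ℂ 1 μ)) (g : Lp ℂ 1 μ) (B : Set Ω) :
    dualMeasure φ g B = φ (projL1 μ B g) := rfl

theorem projL1_of_null {B : Set Ω} (hB : MeasurableSet B) (h0 : μ B = 0) : projL1 μ B = 0 := by
  ext1 g
  rw [projL1_congr_ae hB MeasurableSet.empty (ae_eq_empty.2 h0) g, projL1_empty]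

/-- Both sides are `c 1_{A ∩ s}`. Exchanging the two sets expresses a functional cut to `A` through
the measure attached to `1_A`. -/
theorem projL1_indicatorConstLp {A s : Set Ω} (hA : MeasurableSet A) (hfin : μ A ≠ ⊤)
    (hs : MeasurableSet s) (hsfin : μ s ≠ ⊤) (c : ℂ) :
    projL1 μ A (indicatorConstLp 1 hs hsfin c)
      = c • projL1 μ s (indicatorConstLp 1 hA hfin (1 : ℂ)) := by
  refine Lp.ext ?_
  filter_upwards [coeFn_projL1 hA (indicatorConstLp 1 hs hsfin c),
    coeFn_projL1 hs (indicatorConstLp 1 hA hfin (1 : ℂ)),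
    Lp.coeFn_smul c (projL1 μ s (indicatorConstLp 1 hA hfin (1 : ℂ))),
    indicatorConstLp_coeFn (p := 1) (hs := hs) (hμs := hsfin) (c := c),
    indicatorConstLp_coeFn (p := 1) (hs := hA) (hμs := hfin) (c := (1 : ℂ))] with x h1 h2 h3 h4 h5
  rw [h1, h3, Pi.smul_apply, h2]
  by_cases hxA : x ∈ A <;> by_cases hxs : x ∈ s <;> simp [hxA, hxs, h4, h5]

/-- Comparing integrals bounds the real part of `c * f` for `c = ±1, ±i`. Adding the bounds for real
and imaginary parts costs a factor 2, which is harmless because only boundedness is needed. -/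
theorem ae_norm_le_of_setIntegral_le {f : Ω → ℂ} [IsFiniteMeasure μ] (hf : Integrable f μ) {C : ℝ}
    (h : ∀ B, MeasurableSet B → ‖∫ x in B, f x ∂μ‖ ≤ C * μ.real B) :
    ∀ᵐ x ∂μ, ‖f x‖ ≤ 2 * C := by
  have key : ∀ c : ℂ, ‖c‖ = 1 → ∀ᵐ x ∂μ, (c * f x).re ≤ C := by
    intro c hc
    refine ae_le_of_forall_setIntegral_le (f := fun x => (c * f x).re) (g := fun _ => C)
      (hf.const_mul c).re (integrable_const C) fun s hs _ => ?_
    have h1 : ∫ x in s, (c * f x).re ∂μ = (c * ∫ x in s, f x ∂μ).re := by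
      rw [← integral_const_mul]
      exact integral_re (hf.const_mul c).integrableOn
    rw [h1, setIntegral_const, smul_eq_mul, mul_comm _ C]
    refine (Complex.re_le_norm _).trans ?_
    rw [norm_mul, hc, one_mul]
    exact h s hs
  filter_upwards [key 1 (by simp), key (-1) (by simp), key Complex.I (by simp),
    key (-Complex.I) (by simp)] with x h1 h2 h3 h4
  simp only [one_mul, neg_mul, Complex.neg_re, Complex.mul_re, Complex.I_re, Complex.I_im,
    zero_mul, zero_sub, neg_neg] at h1 h2 h3 h4
  have h5 := Complex.norm_le_abs_re_add_abs_im (f x)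
  have h6 : |(f x).re| ≤ C := abs_le.2 ⟨by linarith, h1⟩
  have h7 : |(f x).im| ≤ C := abs_le.2 ⟨by linarith, h4⟩
  linarith

/-- On a set of finite measure, functionals on `L¹` are given by bounded measurable functions. -/
theorem exists_bddMeas_of_dual (φ : StrongDual ℂ (Lp ℂ 1 μ)) {A : Set Ω} (hA : MeasurableSet A)
    (hfin : μ A ≠ ⊤) :
    ∃ h : Ω → ℂ, IsBddMeas h ∧ φ ∘L projL1 μ A = intL1 μ ∘L mulL1 μ h := by
  -- The representing function is the density of `B ↦ φ(1_{A ∩ B})`; it is bounded because `|φ(1_{A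
  -- ∩ B})| ≤ ‖φ‖ μ(A ∩ B)`.
  let e : Lp ℂ 1 μ := indicatorConstLp 1 hA hfin (1 : ℂ)
  obtain ⟨f, hfm, hfi, hf0, hf⟩ := ComplexMeasure.exists_density (dualMeasure φ e) hA hfin
    fun B hB h0 => by rw [dualMeasure_apply, projL1_of_null hB h0, zero_apply, map_zero]
  have hef : ∀ B, MeasurableSet B → ∫ x in B, f x ∂μ = φ (projL1 μ B e) := by
    intro B hB
    rw [hf B hB, dualMeasure_apply]
    congr 1
    refine Lp.ext ?_
    filter_upwards [coeFn_projL1 hB e, coeFn_projL1 (hB.inter hA) e,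
      indicatorConstLp_coeFn (p := 1) (hs := hA) (hμs := hfin) (c := (1 : ℂ))] with x h1 h2 h3
    rw [h1, h2]
    by_cases hxA : x ∈ A <;> by_cases hxB : x ∈ B <;> simp [hxA, hxB, e, h3]
  have : IsFiniteMeasure (μ.restrict A) := ⟨by simpa using hfin.lt_top⟩
  have hbound : ∀ᵐ x ∂μ, ‖f x‖ ≤ 2 * ‖φ‖ := by
    refine ae_of_ae_restrict_of_ae_restrict_compl A
      (ae_norm_le_of_setIntegral_le hfi.integrableOn fun B hB => ?_)
      ((ae_restrict_iff' hA.compl).2 (Eventually.of_forall fun x hx => ?_))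
    · rw [Measure.restrict_restrict hB, hef _ (hB.inter hA)]
      refine (φ.le_opNorm _).trans (mul_le_mul_of_nonneg_left ?_ (norm_nonneg _))
      rw [norm_projL1_apply (hB.inter hA), measureReal_restrict_apply hB]
      refine (integral_congr_ae (g := fun _ => (1 : ℝ)) ?_).trans_le (by simp)
      filter_upwards [ae_restrict_of_ae (indicatorConstLp_coeFn (p := 1) (hs := hA) (hμs := hfin)
        (c := (1 : ℂ))), ae_restrict_mem (hB.inter hA)] with x h1 h2
      rw [h1]
      simp [h2.2]
    · rw [hf0 x hx, norm_zero]
      positivity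
  -- Truncation turns the almost everywhere bound into the everywhere bound demanded by `IsBddMeas`.
  let h : Ω → ℂ := {x | ‖f x‖ ≤ 2 * ‖φ‖}.indicator f
  have hh : IsBddMeas h := by
    refine ⟨hfm.indicator (measurableSet_le hfm.measurable.norm measurable_const), 2 * ‖φ‖,
      fun x => ?_⟩
    simp only [h]
    by_cases hx : ‖f x‖ ≤ 2 * ‖φ‖
    · rwa [Set.indicator_of_mem (show x ∈ {x | ‖f x‖ ≤ 2 * ‖φ‖} from hx)]
    · rw [Set.indicator_of_notMem (show x ∉ {x | ‖f x‖ ≤ 2 * ‖φ‖} from hx), norm_zero]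
      positivity
  have hhf : h =ᵐ[μ] f := by
    filter_upwards [hbound] with x hx
    exact Set.indicator_of_mem (show x ∈ {x | ‖f x‖ ≤ 2 * ‖φ‖} from hx) _
  refine ⟨h, hh, ContinuousLinearMap.ext fun g => ?_⟩
  induction g using Lp.induction (ENNReal.one_ne_top) with
  | @indicatorConst c s hs hsfin =>
    rw [Lp.simpleFunc.coe_indicatorConst, ContinuousLinearMap.comp_apply,
      projL1_indicatorConstLp hA hfin hs hsfin.ne, map_smul, ← hef s hs,
      ContinuousLinearMap.comp_apply, intL1_mulL1 hh, ← integral_indicator hs, ← integral_smul]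
    refine integral_congr_ae ?_
    filter_upwards [hhf, indicatorConstLp_coeFn (p := 1) (hs := hs) (hμs := hsfin.ne) (c := c)]
      with x h1 h2
    rw [h1, h2]
    by_cases hx : x ∈ s <;> simp [hx, mul_comm]
  | add hf hg _ h1 h2 => rw [map_add, map_add, h1, h2]
  | isClosed => exact isClosed_eq (map_continuous _) (map_continuous _)

end Densities

/-! ### Limits along nets and invariance of Mazur's property -/

section Nets

universe u v

/-- The product of a preorder with an indiscrete two-point set. -/
structure Interlace (ι : Type u) where
  /-- The first component. -/
  index : ι
  /-- The second component. -/
  mark : Bool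

namespace Interlace

instance (ι : Type u) [Preorder ι] : Preorder (Interlace ι) := Preorder.lift Interlace.index

instance (ι : Type u) [Preorder ι] [IsDirectedOrder ι] : IsDirectedOrder (Interlace ι) :=
  ⟨fun a b => let ⟨c, hac, hbc⟩ := exists_ge_ge a.index b.index; ⟨⟨c, true⟩, hac, hbc⟩⟩

instance (ι : Type u) [Nonempty ι] : Nonempty (Interlace ι) :=
  ‹Nonempty ι›.map fun i => ⟨i, true⟩

theorem mk_le (ι : Type u) {κ : Cardinal.{u}} (hκ : Cardinal.aleph0 ≤ κ)
    (h : Cardinal.mk ι ≤ κ) : Cardinal.mk (Interlace ι) ≤ κ := by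
  have e : Interlace ι ≃ ι × Bool :=
    ⟨fun p => (p.index, p.mark), fun p => ⟨p.1, p.2⟩, fun _ => rfl, fun _ => rfl⟩
  have h1 : Cardinal.mk (Interlace ι) = Cardinal.mk ι * 2 := by
    rw [Cardinal.mk_congr e]
    simp
  rw [h1]
  exact Cardinal.mul_le_of_le hκ h ((Cardinal.ofNat_lt_aleph0 (n := 2)).le.trans hκ)

theorem tendsto_index (ι : Type u) [Preorder ι] :
    Tendsto (Interlace.index : Interlace ι → ι) atTop atTop :=
  tendsto_atTop.2 fun i => (eventually_ge_atTop (⟨i, true⟩ : Interlace ι)).mono fun _ h => h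

theorem tendsto_mk (ι : Type u) [Preorder ι] (b : Bool) :
    Tendsto (fun i : ι => (⟨i, b⟩ : Interlace ι)) atTop atTop :=
  tendsto_atTop.2 fun p => (eventually_ge_atTop p.index).mono fun _ h => h

end Interlace

variable {X : Type v} [NormedAddCommGroup X] [NormedSpace ℂ X]

/-- `m` respects limits of bounded weak-* convergent nets indexed by directed sets of cardinality
at most `κ`. -/
def PreservesNetLimits (κ : Cardinal.{u}) (m : StrongDual ℂ (StrongDual ℂ X)) : Prop :=
  ∀ (ι : Type u) [Preorder ι] [IsDirectedOrder ι] [Nonempty ι], Cardinal.mk ι ≤ κ →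
    ∀ (h : ι → StrongDual ℂ X) (l : StrongDual ℂ X), (∃ C : ℝ, ∀ i, ‖h i‖ ≤ C) →
      (∀ x, Tendsto (fun i => h i x) atTop (𝓝 (l x))) →
      Tendsto (fun i => m (h i)) atTop (𝓝 (m l))

theorem tendsto_toWeakDual_iff {ι : Type*} {F : Filter ι} {h : ι → StrongDual ℂ X}
    {l : WeakDual ℂ X} :
    Tendsto (fun i => StrongDual.toWeakDual (h i)) F (𝓝 l) ↔
      ∀ x, Tendsto (fun i => h i x) F (𝓝 (l x)) :=
  tendsto_iff_forall_eval_tendsto_topDualPairing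

/-- A functional mapping bounded weak-* convergent nets to convergent ones preserves the limits. -/
theorem PreservesNetLimits.of_convergent {κ : Cardinal.{u}} (hκ : Cardinal.aleph0 ≤ κ)
    {m : StrongDual ℂ (StrongDual ℂ X)}
    (hm : ∀ (ι : Type u) [Preorder ι] [IsDirectedOrder ι] [Nonempty ι], Cardinal.mk ι ≤ κ →
      ∀ h : ι → StrongDual ℂ X, (∃ C : ℝ, ∀ i, ‖h i‖ ≤ C) →
        (∃ l : WeakDual ℂ X,
          Tendsto (fun i => StrongDual.toWeakDual (h i)) atTop (𝓝 l)) →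
        ∃ a : ℂ, Tendsto (fun i => m (h i)) atTop (𝓝 a)) :
    PreservesNetLimits κ m := by
  intro ι _ _ _ hι h l ⟨C, hC⟩ hl
  -- The net is interlaced with the constant `l`. The result still tends to `l`, so its image under
  -- `m` converges, and the constant subnet forces the limit to be `m l`.
  let h' : Interlace ι → StrongDual ℂ X := fun p => if p.mark then h p.index else l
  obtain ⟨a, ha⟩ := hm (Interlace ι) (Interlace.mk_le ι hκ hι) h' ⟨max C ‖l‖, fun p => by
      rcases p with ⟨i, _ | _⟩
      · exact le_max_right _ _
      · exact (hC i).trans (le_max_left _ _)⟩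
    ⟨StrongDual.toWeakDual l, tendsto_toWeakDual_iff.2 fun x U hU => by
      change ∀ᶠ p in atTop, h' p x ∈ U
      filter_upwards [(Interlace.tendsto_index ι).eventually ((hl x).eventually_mem hU)] with p hp
      rcases p with ⟨i, _ | _⟩
      · exact mem_of_mem_nhds hU
      · exact hp⟩
  have h1 : Tendsto (fun _ : ι => m l) atTop (𝓝 a) := ha.comp (Interlace.tendsto_mk ι false)
  have h2 : Tendsto (fun i : ι => m (h i)) atTop (𝓝 a) := ha.comp (Interlace.tendsto_mk ι true)
  rwa [tendsto_nhds_unique tendsto_const_nhds h1]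

/-- Lifting the universe of a countable index set makes sequences and nets of finite subsets of `ℕ`
available for every infinite `κ`. -/
theorem PreservesNetLimits.of_countable {κ : Cardinal.{u}} (hκ : Cardinal.aleph0 ≤ κ)
    {m : StrongDual ℂ (StrongDual ℂ X)} (hm : PreservesNetLimits κ m) {ι : Type} [Preorder ι]
    [IsDirectedOrder ι] [Nonempty ι] [Countable ι] {h : ι → StrongDual ℂ X} {l : StrongDual ℂ X}
    {C : ℝ} (hC : ∀ i, ‖h i‖ ≤ C) (hl : ∀ x, Tendsto (fun i => h i x) atTop (𝓝 (l x))) :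
    Tendsto (fun i => m (h i)) atTop (𝓝 (m l)) := by
  have : IsDirectedOrder (ULift.{u} ι) :=
    ⟨fun a b => let ⟨c, hac, hbc⟩ := exists_ge_ge a.down b.down; ⟨⟨c⟩, hac, hbc⟩⟩
  have hdown : Tendsto (ULift.down : ULift.{u} ι → ι) atTop atTop :=
    tendsto_atTop.2 fun i => (eventually_ge_atTop (ULift.up i)).mono fun _ h => h
  have hup : Tendsto (ULift.up : ι → ULift.{u} ι) atTop atTop :=
    tendsto_atTop.2 fun i => (eventually_ge_atTop i.down).mono fun _ h => h
  exact (hm (ULift.{u} ι) (Cardinal.mk_le_aleph0.trans hκ) (fun i => h i.down) l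
    ⟨C, fun i => hC _⟩ fun x => (hl x).comp hdown).comp hup

/-- Mazur's property is invariant under isomorphisms. -/
theorem HasMazurProperty.of_equiv {κ : Cardinal.{u}} {Y : Type*} [NormedAddCommGroup Y]
    [NormedSpace ℂ Y] (e : X ≃L[ℂ] Y) (hY : HasMazurProperty Y κ) : HasMazurProperty X κ := by
  intro m hm
  let T : StrongDual ℂ Y →L[ℂ] StrongDual ℂ X :=
    (ContinuousLinearMap.compL ℂ X Y ℂ).flip (e : X →L[ℂ] Y)
  have hT : ∀ (φ : StrongDual ℂ Y) x, T φ x = φ (e x) := fun _ _ => rfl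
  obtain ⟨y, hy⟩ := hY (m ∘L T) fun ι _ _ _ hι h ⟨C, hC⟩ ⟨l, hl⟩ => by
    refine hm ι hι (fun i => T (h i)) ⟨‖T‖ * C, fun i => ?_⟩
      ⟨StrongDual.toWeakDual (T (WeakDual.toStrongDual l)), ?_⟩
    · exact (T.le_opNorm _).trans (mul_le_mul_of_nonneg_left (hC i) (norm_nonneg _))
    · rw [tendsto_toWeakDual_iff] at hl ⊢
      exact fun x => hl (e x)
  refine ⟨e.symm y, ContinuousLinearMap.ext fun φ => ?_⟩
  have h1 := congrArg (fun M => M (φ ∘L (e.symm : Y →L[ℂ] X))) hy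
  have h2 : T (φ ∘L (e.symm : Y →L[ℂ] X)) = φ := by ext x; simp [hT]
  simpa [h2] using h1

end Nets

/-! ### Mazur's property for `L¹` of a decomposed measure space -/

section MazurL1

universe u v w

variable {Ω : Type v} [MeasurableSpace Ω] {μ : Measure Ω} {κ : Cardinal.{u}}
  {m : StrongDual ℂ (StrongDual ℂ (Lp ℂ 1 μ))}

theorem norm_comp_projL1_le (φ : StrongDual ℂ (Lp ℂ 1 μ)) (B : Set Ω) :
    ‖φ ∘L projL1 μ B‖ ≤ ‖φ‖ :=
  (φ.opNorm_comp_le _).trans (mul_le_of_le_one_right (norm_nonneg _) (norm_projL1_le μ B))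

theorem comp_sum_projL1 {J : Type*} {B : J → Set Ω} (hB : ∀ j, MeasurableSet (B j))
    (hd : Pairwise (Function.onFun Disjoint B)) (φ : StrongDual ℂ (Lp ℂ 1 μ)) (F : Finset J) :
    ∑ j ∈ F, m (φ ∘L projL1 μ (B j)) = m (φ ∘L projL1 μ (⋃ j ∈ F, B j)) := by
  rw [← map_sum, ← sum_projL1 hB hd, ContinuousLinearMap.comp_finsetSum]

/-- The complex measure `B ↦ m (1_B)` associated with a functional `m` on `(L¹)*`. -/
noncomputable def bidualMeasure (hκ : Cardinal.aleph0 ≤ κ) (hm : PreservesNetLimits κ m) :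
    ComplexMeasure Ω where
  measureOf' B := m (intL1 μ ∘L projL1 μ B)
  empty' := by simp
  not_measurable' B hB := by simp [projL1_of_not_measurableSet hB]
  m_iUnion' B hB hd := by
    rw [HasSum, SummationFilter.unconditional_filter]
    simp_rw [comp_sum_projL1 hB hd]
    refine hm.of_countable hκ (fun F => norm_comp_projL1_le _ _) fun g => ?_
    have h := (hasSum_projL1_iUnion hB hd g).mapL (intL1 μ)
    rw [HasSum, SummationFilter.unconditional_filter] at h
    refine h.congr fun F => ?_
    rw [← map_sum, ← sum_apply, sum_projL1 hB hd]
    rfl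

theorem bidualMeasure_apply (hκ : Cardinal.aleph0 ≤ κ) (hm : PreservesNetLimits κ m)
    (B : Set Ω) : bidualMeasure hκ hm B = m (intL1 μ ∘L projL1 μ B) := rfl

theorem mulL1_simpleFunc_add (s t : SimpleFunc Ω ℂ) :
    mulL1 μ (s + t) = mulL1 μ s + mulL1 μ t := by
  ext1 g
  refine Lp.ext ?_
  filter_upwards [coeFn_mulL1 (IsBddMeas.simpleFunc (s + t)) g,
    coeFn_mulL1 (IsBddMeas.simpleFunc s) g, coeFn_mulL1 (IsBddMeas.simpleFunc t) g,
    Lp.coeFn_add (mulL1 μ s g) (mulL1 μ t g)] with x h1 h2 h3 h4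
  rw [SimpleFunc.coe_add] at h1
  rw [h1, add_apply, h4, Pi.add_apply, Pi.add_apply, h2, h3, add_mul]

theorem mulL1_simpleFunc_piecewise {s : Set Ω} (hs : MeasurableSet s) (c : ℂ) :
    mulL1 μ (SimpleFunc.piecewise s hs (SimpleFunc.const _ c) (SimpleFunc.const _ 0))
      = c • projL1 μ s := by
  ext1 g
  refine Lp.ext ?_
  filter_upwards [coeFn_mulL1 (IsBddMeas.simpleFunc
    (SimpleFunc.piecewise s hs (SimpleFunc.const _ c) (SimpleFunc.const _ 0))) g,
    coeFn_projL1 hs g, Lp.coeFn_smul c (projL1 μ s g)] with x h1 h2 h3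
  rw [h1, smul_apply, h3, Pi.smul_apply, h2]
  by_cases hx : x ∈ s <;> simp [hx]

/-- On a set of finite measure, a limit preserving functional on `(L¹)*` is given by an element of
`L¹`. -/
theorem exists_L1_of_preservesNetLimits (hκ : Cardinal.aleph0 ≤ κ) (hm : PreservesNetLimits κ m)
    {A : Set Ω} (hA : MeasurableSet A) (hfin : μ A ≠ ⊤) :
    ∃ f : Lp ℂ 1 μ, projL1 μ A f = f ∧ ∀ φ, m (φ ∘L projL1 μ A) = φ f := by
  obtain ⟨f₀, -, hfi, hf0, hf⟩ := ComplexMeasure.exists_density (bidualMeasure hκ hm) hA hfin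
    fun B hB h0 => by simp [bidualMeasure_apply, projL1_of_null hB h0]
  have hff : hfi.toL1 f₀ =ᵐ[μ] f₀ := Integrable.coeFn_toL1 _
  set f : Lp ℂ 1 μ := hfi.toL1 f₀
  have hfA : projL1 μ A f = f := by
    refine Lp.ext ?_
    filter_upwards [coeFn_projL1 hA f, hff] with x h1 h2
    rw [h1]
    by_cases hx : x ∈ A
    · simp [hx]
    · simp [hx, h2, hf0 x hx]
  refine ⟨f, hfA, fun φ => ?_⟩
  -- By linearity the density formula passes from indicators to simple functions; bounded functions
  -- then follow by dominated convergence.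
  have hsimple : ∀ s : SimpleFunc Ω ℂ,
      m (intL1 μ ∘L (mulL1 μ s ∘L projL1 μ A)) = ∫ x, s x * f x ∂μ := by
    intro s
    induction s using SimpleFunc.induction with
    | @const c B hs =>
      have h1 : projL1 μ B ∘L projL1 μ A = projL1 μ (B ∩ A) :=
        ContinuousLinearMap.ext fun g => projL1_projL1 hs hA g
      rw [mulL1_simpleFunc_piecewise, ContinuousLinearMap.smul_comp, h1,
        ContinuousLinearMap.comp_smul, map_smul, ← bidualMeasure_apply hκ hm, ← hf B hs,
        smul_eq_mul, ← integral_const_mul, ← integral_indicator hs]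
      refine integral_congr_ae ?_
      filter_upwards [hff] with x hx
      by_cases hxB : x ∈ B <;> simp [hxB, hx]
    | @add s t _ hs ht =>
      rw [SimpleFunc.coe_add, mulL1_simpleFunc_add, ContinuousLinearMap.add_comp,
        ContinuousLinearMap.comp_add, map_add, hs, ht, ← integral_add
          ((IsBddMeas.simpleFunc s).integrable_mul (L1.integrable_coeFn f))
          ((IsBddMeas.simpleFunc t).integrable_mul (L1.integrable_coeFn f))]
      simp [add_mul]
  obtain ⟨h, hh, hφ⟩ := exists_bddMeas_of_dual φ hA hfin
  obtain ⟨C, hC⟩ := hh.2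
  have hC0 : ∀ x, ‖h x‖ ≤ max C 0 := fun x => (hC x).trans (le_max_left _ _)
  let s : ℕ → SimpleFunc Ω ℂ := hh.1.approxBounded (max C 0)
  have hs : ∀ n x, ‖s n x‖ ≤ max C 0 := hh.1.norm_approxBounded_le (le_max_right _ _)
  have hlim : ∀ x, Tendsto (fun n => s n x) atTop (𝓝 (h x)) := fun x =>
    hh.1.tendsto_approxBounded_of_norm_le (hC0 x)
  have hint : ∀ g : Lp ℂ 1 μ, Tendsto (fun n => ∫ x, s n x * g x ∂μ) atTop
      (𝓝 (∫ x, h x * g x ∂μ)) := by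
    intro g
    refine tendsto_integral_of_dominated_convergence (fun x => max C 0 * ‖g x‖)
      (fun n => ((IsBddMeas.simpleFunc (s n)).integrable_mul
        (L1.integrable_coeFn g)).aestronglyMeasurable)
      ((L1.integrable_coeFn g).norm.const_mul _)
      (fun n => Eventually.of_forall fun x => ?_)
      (Eventually.of_forall fun x => (hlim x).mul_const _)
    rw [norm_mul]
    exact mul_le_mul_of_nonneg_right (hs n x) (norm_nonneg _)
  have hφA : φ ∘L projL1 μ A = intL1 μ ∘L (mulL1 μ h ∘L projL1 μ A) := by
    rw [← ContinuousLinearMap.comp_assoc, ← hφ, ContinuousLinearMap.comp_assoc]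
    congr 1
    ext1 g
    rw [ContinuousLinearMap.comp_apply, projL1_projL1 hA hA, Set.inter_self]
  have h1 : Tendsto (fun n => m (intL1 μ ∘L (mulL1 μ (s n) ∘L projL1 μ A))) atTop
      (𝓝 (m (φ ∘L projL1 μ A))) := by
    refine hm.of_countable hκ (C := 1 * (max C 0 * 1)) (fun n => ?_) fun g => ?_
    · refine (ContinuousLinearMap.opNorm_comp_le _ _).trans (mul_le_mul (norm_intL1_le μ) ?_
        (norm_nonneg _) zero_le_one)
      exact (ContinuousLinearMap.opNorm_comp_le _ _).trans (mul_le_mul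
        (norm_mulL1_le (s n).stronglyMeasurable (le_max_right _ _) (hs n)) (norm_projL1_le μ A)
        (norm_nonneg _) (le_max_right _ _))
    · rw [hφA]
      simp only [ContinuousLinearMap.comp_apply, intL1_mulL1 hh,
        fun n => intL1_mulL1 (μ := μ) (IsBddMeas.simpleFunc (s n))]
      exact hint _
  have h2 : φ f = ∫ x, h x * f x ∂μ := by
    rw [← intL1_mulL1 hh, ← ContinuousLinearMap.comp_apply, ← hφ, ContinuousLinearMap.comp_apply,
      hfA]
  simp_rw [hsimple] at h1
  rw [h2]
  exact tendsto_nhds_unique h1 (hint f)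

/-- `L¹` of a measure space which is decomposed into at most `κ` sets of finite measure has
Mazur's property of level `κ`. -/
theorem hasMazurProperty_L1 {J : Type u} (hκ : Cardinal.aleph0 ≤ κ) (hJ : Cardinal.mk J ≤ κ)
    {A : J → Set Ω} (hA : ∀ j, MeasurableSet (A j)) (hd : Pairwise (Function.onFun Disjoint A))
    (hfin : ∀ j, μ (A j) ≠ ⊤)
    (hsum : ∀ g : Lp ℂ 1 μ, HasSum (fun j => ∫ x in A j, ‖g x‖ ∂μ) (∫ x, ‖g x‖ ∂μ)) :
    HasMazurProperty (Lp ℂ 1 μ) κ := by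
  classical
  intro m hm'
  have hm : PreservesNetLimits κ m := .of_convergent hκ hm'
  choose f hfA hf using fun j => exists_L1_of_preservesNetLimits hκ hm (hA j) (hfin j)
  -- By duality: `φ` of the partial sum is `m` of `φ` cut to `⋃ j ∈ F, A j`, and cutting does not
  -- increase the norm.
  have hbound : ∀ F : Finset J, ‖∑ j ∈ F, f j‖ ≤ ‖m‖ := by
    intro F
    refine NormedSpace.norm_le_dual_bound ℂ _ (norm_nonneg m) fun φ => ?_
    rw [map_sum]
    simp_rw [← hf]
    rw [comp_sum_projL1 hA hd]
    exact (m.le_opNorm _).trans (mul_le_mul_of_nonneg_left (norm_comp_projL1_le _ _)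
      (norm_nonneg _))
  have hsummable : Summable f := by
    refine Summable.of_norm (summable_of_sum_le (fun _ => norm_nonneg _) (c := ‖m‖) fun F => ?_)
    -- The `f j` live on disjoint sets, so each is the part on `A j` of the partial sum and the
    -- norms add up.
    have h1 : ∀ j ∈ F, ‖f j‖ = ∫ x in A j, ‖(∑ k ∈ F, f k : Lp ℂ 1 μ) x‖ ∂μ := by
      intro j hj
      rw [← norm_projL1_apply (hA j), map_sum, Finset.sum_eq_single j _ (fun h => absurd hj h),
        hfA]
      intro k _ hkj
      rw [← hfA k, projL1_projL1 (hA j) (hA k), (hd hkj.symm).inter_eq, projL1_empty, zero_apply]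
    rw [Finset.sum_congr rfl h1]
    refine le_trans (sum_le_hasSum F (fun j _ => integral_nonneg fun x => norm_nonneg _)
      (hsum _)) ?_
    rw [← L1.norm_eq_integral_norm]
    exact hbound F
  refine ⟨∑' j, f j, ContinuousLinearMap.ext fun φ => ?_⟩
  rw [NormedSpace.dual_def]
  have h1 : Tendsto (fun F : Finset J => ∑ j ∈ F, φ (f j)) atTop (𝓝 (φ (∑' j, f j))) := by
    simpa [HasSum] using hsummable.hasSum.mapL φ
  have hFin : Cardinal.mk (Finset J) ≤ κ := by
    rcases finite_or_infinite J with h | h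
    · exact Cardinal.mk_le_aleph0.trans hκ
    · rwa [Cardinal.mk_finset_of_infinite]
  -- The only net that may be uncountable: it is indexed by the finite subsets of `J`.
  have h2 : Tendsto (fun F : Finset J => m (φ ∘L projL1 μ (⋃ j ∈ F, A j))) atTop (𝓝 (m φ)) := by
    refine hm (Finset J) hFin _ _ ⟨‖φ‖, fun F => norm_comp_projL1_le _ _⟩ fun g => ?_
    have h3 := (hasSum_projL1 hA hd MeasurableSet.univ (fun _ => Set.subset_univ _)
      (by simpa using hsum g)).mapL φ
    rw [HasSum, SummationFilter.unconditional_filter, projL1_univ] at h3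
    refine h3.congr fun F => ?_
    rw [← map_sum, ← sum_apply, sum_projL1 hA hd]
    rfl
  simp_rw [← hf, comp_sum_projL1 hA hd] at h1
  exact tendsto_nhds_unique h1 h2

end MazurL1

/-! ### Compact coverings and open σ-compact subgroups -/

section Covering

theorem exists_compact_cover (G : Type*) [TopologicalSpace G] :
    ∃ S : Set (Set G), (∀ K ∈ S, IsCompact K) ∧ ⋃₀ S = Set.univ ∧
      Cardinal.mk S = compactCoveringNumber G := by
  refine csInf_mem (s := {c | ∃ S : Set (Set G), (∀ K ∈ S, IsCompact K) ∧ ⋃₀ S = Set.univ ∧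
    Cardinal.mk S = c}) ⟨_, Set.range (fun x : G => {x}), ?_, ?_, rfl⟩
  · rintro _ ⟨x, rfl⟩
    exact isCompact_singleton
  · exact Set.eq_univ_of_forall fun x => ⟨{x}, ⟨x, rfl⟩, rfl⟩

theorem aleph0_le_compactCoveringNumber_mul (G : Type*) [TopologicalSpace G] [Nonempty G] :
    Cardinal.aleph0 ≤ compactCoveringNumber G * Cardinal.aleph0 := by
  refine Cardinal.le_mul_left ?_
  obtain ⟨S, -, hS, hc⟩ := exists_compact_cover G
  rw [← hc, Cardinal.mk_ne_zero_iff]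
  obtain ⟨K, hK, -⟩ := (Set.ext_iff.1 hS (Classical.arbitrary G)).2 trivial
  exact ⟨⟨K, hK⟩⟩

variable {G : Type*} [Group G] [TopologicalSpace G] [IsTopologicalGroup G]

/-- The quotient is discrete, so each compact set of a minimal covering meets only finitely many
cosets. -/
theorem mk_quotient_le_compactCoveringNumber_mul (H : Subgroup G) (hH : IsOpen (H : Set G)) :
    Cardinal.mk (G ⧸ H) ≤ compactCoveringNumber G * Cardinal.aleph0 := by
  obtain ⟨S, hSc, hS, hc⟩ := exists_compact_cover G
  have := QuotientGroup.discreteTopology hH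
  have hcover : (⋃ K ∈ S, ((↑) : G → G ⧸ H) '' K) = Set.univ := by
    refine Set.eq_univ_of_forall fun c => ?_
    induction c using QuotientGroup.induction_on with
    | H x =>
      obtain ⟨K, hK, hx⟩ := (Set.ext_iff.1 hS x).2 trivial
      exact Set.mem_biUnion hK ⟨x, hx, rfl⟩
  rw [← Cardinal.mk_univ, ← hcover, ← hc]
  refine (Cardinal.mk_biUnion_le _ _).trans (mul_le_mul' le_rfl (ciSup_le' fun K => ?_))
  exact ((hSc K K.2).image QuotientGroup.continuous_mk).finite_of_discrete.lt_aleph0.le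

-- The subgroup generated by a compact neighbourhood `L` of `1` is open and is the union of the
-- powers of `L ∪ L⁻¹`. As `G` need not be Hausdorff, these powers are replaced by their closures,
-- which are still compact and stay inside `H` because open subgroups are closed.
open scoped Pointwise in
theorem exists_open_subgroup_iUnion_compact [LocallyCompactSpace G] :
    ∃ H : Subgroup G, IsOpen (H : Set G) ∧ ∃ C : ℕ → Set G,
      (∀ n, IsCompact (C n) ∧ IsClosed (C n)) ∧ ⋃ n, C n = (H : Set G) := by
  obtain ⟨L, hLc, hL1⟩ := exists_compact_mem_nhds (1 : G)
  let M : Set G := L ∪ L⁻¹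
  let H : Subgroup G := Subgroup.closure L
  have hMc : IsCompact M := hLc.union hLc.inv
  have hMinv : M⁻¹ = M := by simp [M, Set.union_comm]
  have hHo : IsOpen (H : Set G) :=
    Subgroup.isOpen_of_mem_nhds H (mem_of_superset hL1 Subgroup.subset_closure)
  have hMH : M ⊆ H := Set.union_subset Subgroup.subset_closure
    fun x hx => inv_mem_iff.1 (Subgroup.subset_closure hx : x⁻¹ ∈ H)
  have hpowH : ∀ n, M ^ n ⊆ H := by
    intro n
    induction n with
    | zero => simp
    | succ n ih =>
      rw [pow_succ]
      rintro _ ⟨a, ha, b, hb, rfl⟩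
      exact H.mul_mem (ih ha) (hMH hb)
  have hpowc : ∀ n, IsCompact (M ^ n) := by
    intro n
    induction n with
    | zero => simp
    | succ n ih => rw [pow_succ]; exact ih.mul hMc
  refine ⟨H, hHo, fun n => closure (M ^ n), fun n => ⟨(hpowc n).closure, isClosed_closure⟩,
    Set.Subset.antisymm (Set.iUnion_subset fun n =>
      closure_minimal (hpowH n) (H.isClosed_of_isOpen hHo)) fun x hx => ?_⟩
  suffices h : ∃ n, x ∈ M ^ n from
    let ⟨n, hn⟩ := h; Set.mem_iUnion.2 ⟨n, subset_closure hn⟩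
  induction hx using Subgroup.closure_induction with
  | mem x hx => exact ⟨1, (pow_one M).superset (Set.mem_union_left _ hx)⟩
  | one => exact ⟨0, by simp⟩
  | mul x y _ _ hx hy =>
    obtain ⟨n, hn⟩ := hx
    obtain ⟨k, hk⟩ := hy
    exact ⟨n + k, by rw [pow_add]; exact Set.mul_mem_mul hn hk⟩
  | inv x _ hx =>
    obtain ⟨n, hn⟩ := hx
    exact ⟨n, by rw [← hMinv, inv_pow]; exact Set.inv_mem_inv.2 hn⟩

end Covering

/-! ### Integrable functions and partitions into open sets -/

section OpenPartition

variable {G : Type*} [TopologicalSpace G] [MeasurableSpace G] [BorelSpace G]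

/-- An integrable function vanishes outside countably many pieces of a given partition into open
sets. -/
theorem exists_countable_eq_zero_of_integrable (μ : Measure G) [μ.OuterRegular]
    [μ.IsOpenPosMeasure] {Q : Type*} (q : G → Q) (hq : ∀ c, IsOpen (q ⁻¹' {c})) {g : G → ℂ}
    (hg : Integrable g μ) : ∃ T : Set Q, T.Countable ∧ ∀ x, q x ∉ T → g x = 0 := by
  have hfin : ∀ n : ℕ, μ {x | 1 / ((n : ℝ) + 1) ≤ ‖g x‖} < ⊤ := fun n =>
    hg.measure_norm_ge_lt_top (by positivity)
  -- Outer regularity encloses each level set in an open set of finite measure. Such a set meets a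
  -- piece in an open set, which has positive measure unless empty, so it meets only countably many
  -- pieces.
  choose V hSV hVo hV using fun n => Set.exists_isOpen_lt_of_lt _ _ (hfin n)
  refine ⟨⋃ n, {c | 0 < μ (V n ∩ q ⁻¹' {c})}, Set.countable_iUnion fun n => ?_, fun x hx => ?_⟩
  · refine Measure.countable_meas_pos_of_disjoint_of_meas_iUnion_ne_top μ
      (fun c => ((hVo n).inter (hq c)).measurableSet) (fun c d hcd => ?_)
      ((measure_mono (Set.iUnion_subset fun c => Set.inter_subset_left)).trans_lt (hV n)).ne
    exact Disjoint.inter_left' _ (Disjoint.inter_right' _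
      (Disjoint.preimage q (Set.disjoint_singleton.2 hcd)))
  · by_contra h0
    obtain ⟨n, hn⟩ := exists_nat_one_div_lt (norm_pos_iff.2 h0)
    refine hx (Set.mem_iUnion.2 ⟨n, ?_⟩)
    exact ((hVo n).inter (hq _)).measure_pos μ ⟨x, hSV n hn.le, rfl⟩

/-- Only countably many pieces carry `g`, so the sum over a possibly uncountable index set reduces
to countable additivity. -/
theorem hasSum_setIntegral_norm_of_open_partition (μ : Measure G) [μ.OuterRegular]
    [μ.IsOpenPosMeasure] {Q : Type*} (q : G → Q) (hq : ∀ c, IsOpen (q ⁻¹' {c}))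
    {A : Q × ℕ → Set G} (hA : ∀ j, MeasurableSet (A j))
    (hd : Pairwise (Function.onFun Disjoint A)) (hAq : ∀ c, ⋃ n, A (c, n) = q ⁻¹' {c})
    {g : G → ℂ} (hg : Integrable g μ) :
    HasSum (fun j => ∫ x in A j, ‖g x‖ ∂μ) (∫ x, ‖g x‖ ∂μ) := by
  obtain ⟨T, hT, hgT⟩ := exists_countable_eq_zero_of_integrable μ q hq hg
  have hAq' : ∀ j, ∀ x ∈ A j, q x = j.1 := fun j x hx =>
    (hAq j.1).subset (Set.mem_iUnion.2 ⟨j.2, hx⟩)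
  have hcount : Countable {j : Q × ℕ | j.1 ∈ T} := by
    refine ((hT.prod (Set.countable_univ (α := ℕ))).mono fun j hj => ?_).to_subtype
    exact Set.mem_prod.2 ⟨hj, trivial⟩
  have h1 := hasSum_integral_iUnion (μ := μ) (f := fun x => ‖g x‖)
    (s := fun j : {j : Q × ℕ | j.1 ∈ T} => A j) (fun j => hA j)
    (fun i j hij => hd (Subtype.coe_injective.ne hij)) hg.norm.integrableOn
  rw [setIntegral_eq_integral_of_forall_compl_eq_zero] at h1
  · refine (hasSum_subtype_iff_of_support_subset (s := {j : Q × ℕ | j.1 ∈ T})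
      (f := fun j => ∫ x in A j, ‖g x‖ ∂μ) ?_).1 h1
    intro j hj
    by_contra hjT
    refine hj (setIntegral_eq_zero_of_forall_eq_zero fun x hx => ?_)
    rw [hgT x (by rwa [hAq' j x hx]), norm_zero]
  · intro x hx
    rw [hgT x, norm_zero]
    intro hxT
    obtain ⟨n, hn⟩ := Set.mem_iUnion.1 ((hAq (q x)).superset rfl)
    exact hx (Set.mem_iUnion.2 ⟨⟨(q x, n), hxT⟩, hn⟩)

end OpenPartition

/-! ### Locally compact groups and weights -/

section Group

variable {G : Type*} [TopologicalSpace G] [Group G] [MeasurableSpace G] [BorelSpace G]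

/-- Multiplication by the weight is an isometric isomorphism from `L₁(G, w)` onto `L₁(G)`. -/
noncomputable def WeightedL1.equivL1 (μ : Measure G) (w : GroupWeight G) :
    WeightedL1 μ w ≃ₗᵢ[ℂ] Lp ℂ 1 μ :=
  LinearIsometryEquiv.ofSurjective ⟨WeightedL1.mulWeight μ w, fun _ => rfl⟩ fun g => by
    have hw : Continuous fun x => (w x : ℂ)⁻¹ :=
      (Complex.continuous_ofReal.comp w.continuous_toFun).inv₀
        fun x => Complex.ofReal_ne_zero.2 (w.pos x).ne'
    have hm : AEStronglyMeasurable (fun x => (w x : ℂ)⁻¹ * g x) μ :=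
      hw.measurable.aestronglyMeasurable.mul (L1.integrable_coeFn g).aestronglyMeasurable
    have hae : (fun x => (w x : ℂ) * AEEqFun.mk _ hm x) =ᵐ[μ] g := by
      filter_upwards [AEEqFun.coeFn_mk _ hm] with x hx
      rw [hx, mul_inv_cancel_left₀ (Complex.ofReal_ne_zero.2 (w.pos x).ne')]
    have hi : Integrable (fun x => (w x : ℂ) * AEEqFun.mk _ hm x) μ :=
      (L1.integrable_coeFn g).congr hae.symm
    exact ⟨⟨AEEqFun.mk _ hm, hi⟩, Lp.ext ((Integrable.coeFn_toL1 hi).trans hae)⟩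

theorem hasMazurProperty_L1_group [IsTopologicalGroup G] [LocallyCompactSpace G]
    (μ : Measure G) [μ.OuterRegular] [μ.IsOpenPosMeasure] [IsFiniteMeasureOnCompacts μ] :
    HasMazurProperty (Lp ℂ 1 μ) (compactCoveringNumber G * Cardinal.aleph0) := by
  obtain ⟨H, hHo, C, hC, hCH⟩ := exists_open_subgroup_iUnion_compact (G := G)
  have hκ := aleph0_le_compactCoveringNumber_mul G
  let D : ℕ → Set G := disjointed C
  have hDm : ∀ n, MeasurableSet (D n) := .disjointed fun n => (hC n).2.measurableSet
  have hDH : ⋃ n, D n = (H : Set G) := iUnion_disjointed.trans hCH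
  -- Each coset is cut by translating the disjoint pieces of `H` with a chosen representative; every
  -- piece lies in a translate of a compact set, hence has finite measure.
  let A : (G ⧸ H) × ℕ → Set G := fun j => (fun x => j.1.out⁻¹ * x) ⁻¹' D j.2
  have hA : ∀ j, MeasurableSet (A j) := fun j =>
    (continuous_const_mul j.1.out⁻¹).measurable (hDm j.2)
  have hAq : ∀ c, ⋃ n, A (c, n) = ((↑) : G → G ⧸ H) ⁻¹' {c} := by
    intro c
    have h : ⋃ n, A (c, n) = (fun x => c.out⁻¹ * x) ⁻¹' (H : Set G) := by
      rw [← hDH, Set.preimage_iUnion]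
    rw [h]
    ext x
    rw [Set.mem_preimage, SetLike.mem_coe, ← QuotientGroup.eq, QuotientGroup.out_eq', eq_comm]
    rfl
  have hd : Pairwise (Function.onFun Disjoint A) := by
    rintro ⟨c, n⟩ ⟨d, k⟩ hne
    refine Set.disjoint_left.2 fun x hx hy => hne ?_
    have h1 : (x : G ⧸ H) = c := (hAq c).subset (Set.mem_iUnion.2 ⟨n, hx⟩)
    have h2 : (x : G ⧸ H) = d := (hAq d).subset (Set.mem_iUnion.2 ⟨k, hy⟩)
    obtain rfl : c = d := h1.symm.trans h2
    by_contra h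
    refine Set.disjoint_left.1 (disjoint_disjointed C (i := n) (j := k) ?_) hx hy
    exact fun h' => h (by rw [h'])
  have hfin : ∀ j, μ (A j) ≠ ⊤ := fun j => by
    refine ((measure_mono (Set.preimage_mono (disjointed_subset C j.2))).trans_lt ?_).ne
    exact ((Homeomorph.mulLeft j.1.out⁻¹).isCompact_preimage.2 (hC j.2).1).measure_lt_top
  refine hasMazurProperty_L1 (J := (G ⧸ H) × ℕ) hκ ?_ hA hd hfin fun g => ?_
  · rw [Cardinal.mk_prod, Cardinal.lift_uzero, Cardinal.mk_nat, Cardinal.lift_aleph0]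
    exact Cardinal.mul_le_of_le hκ (mk_quotient_le_compactCoveringNumber_mul H hHo) hκ
  · have := QuotientGroup.discreteTopology hHo
    exact hasSum_setIntegral_norm_of_open_partition μ ((↑) : G → G ⧸ H)
      (fun c => (isOpen_discrete {c}).preimage QuotientGroup.continuous_mk) hA hd hAq
      (L1.integrable_coeFn g)

end Group

theorem proposition2p1 {G : Type*} [Group G] [TopologicalSpace G] [IsTopologicalGroup G]
    [LocallyCompactSpace G] [MeasurableSpace G] [BorelSpace G]
    (μ : Measure G) [μ.IsHaarMeasure] [μ.Regular] (w : GroupWeight G) :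
    HasMazurProperty (WeightedL1 μ w) (compactCoveringNumber G * Cardinal.aleph0) :=
  (hasMazurProperty_L1_group μ).of_equiv (WeightedL1.equivL1 μ w).toContinuousLinearEquiv
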